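/- Let $E$ be a real Banach lattice with the positive Schur property, i.e. every weakly null sequence $(x_n)$ in $E$ with $x_n\ge 0$ for all $n$ satisfies $\|x_n\|\to 0$, and let $T:E\to E$ be a bounded linear operator. Then $T$ is uo-demi Dunford–Pettis if and only if $T$ is un-demi Dunford–Pettis. Here a sequence $(x_n)$ in $E$ is order null if there is a net $(z_\gamma)$ in $E$ with $z_\gamma\downarrow 0$ such that for every $\gamma$ there is $n_0$ with $|x_n|\le z_\gamma$ for all $n\ge n_0$; it is uo-null if $(|x_n|\wedge y)_n$ is order null for every $y\in E^+$; and it is un-null if $\||x_n|\wedge y\|\to 0$ for every $y\in E^+$. The operator $T$ is uo-demi Dunford–Pettis if, for every weakly null sequence $(x_n)$ in $E$ such that $(x_n-Tx_n)$ is uo-null, one has $\|x_n\|\to 0$. The operator $T$ is un-demi Dunford–Pettis if, for every weakly null sequence $(x_n)$ in $E$ such that $(x_n-Tx_n)$ is un-null, the sequence $(x_n)$ is un-null. -/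

import Mathlib

open Filter Topology

namespace BanachLattice

universe u

/-- The sequence `x` converges weakly to `0`. -/
def WeaklyNull {E : Type u} [NormedAddCommGroup E] [NormedSpace ℝ E] (x : ℕ → E) : Prop :=
  ∀ f : StrongDual ℝ E, Tendsto (fun n => f (x n)) atTop (𝓝 0)

/-- The sequence `x` order converges to `a`: there is a net `z`, indexed by some nonempty directed
set `Γ`, that decreases to `0` (it is decreasing with infimum `0`) and such that for every `γ` one
has `|x n - a| ≤ z γ` for all large `n`. The range of `z` lies in `E`, so index sets in the
universe of `E` suffice. -/
def OrderConverges {E : Type u} [AddCommGroup E] [Lattice E] (x : ℕ → E) (a : E) : Prop :=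
  ∃ (Γ : Type u) (_ : Preorder Γ) (_ : Nonempty Γ) (_ : IsDirected Γ (· ≤ ·)) (z : Γ → E),
    Antitone z ∧ IsGLB (Set.range z) 0 ∧
      ∀ γ : Γ, ∃ n₀ : ℕ, ∀ n, n₀ ≤ n → |x n - a| ≤ z γ

/-- Unbounded order convergence: `|x n - a| ⊓ y` order converges to `0` for every `y ≥ 0`. -/
def UOConverges {E : Type u} [AddCommGroup E] [Lattice E] (x : ℕ → E) (a : E) : Prop :=
  ∀ y : E, 0 ≤ y → OrderConverges (fun n => |x n - a| ⊓ y) 0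

/-- Unbounded norm convergence: `|x n - a| ⊓ y` tends to `0` in norm for every `y ≥ 0`. -/
def UNConverges {E : Type u} [NormedAddCommGroup E] [Lattice E] (x : ℕ → E) (a : E) : Prop :=
  ∀ y : E, 0 ≤ y → Tendsto (fun n => ‖|x n - a| ⊓ y‖) atTop (𝓝 0)

/-- The positive Schur property: weakly null sequences with positive terms are norm null. -/
def PositiveSchur (E : Type u) [NormedAddCommGroup E] [NormedSpace ℝ E] [Lattice E] : Prop :=
  ∀ x : ℕ → E, (∀ n, 0 ≤ x n) → WeaklyNull x → Tendsto (fun n => ‖x n‖) atTop (𝓝 0)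

/-- uo-demi Dunford–Pettis operators. -/
def UODemiDunfordPettis {E : Type u} [NormedAddCommGroup E] [NormedSpace ℝ E] [Lattice E]
    (T : E →L[ℝ] E) : Prop :=
  ∀ x : ℕ → E, WeaklyNull x → UOConverges (fun n => x n - T (x n)) 0 →
    Tendsto (fun n => ‖x n‖) atTop (𝓝 0)

/-- un-demi Dunford–Pettis operators. -/
def UNDemiDunfordPettis {E : Type u} [NormedAddCommGroup E] [NormedSpace ℝ E] [Lattice E]
    (T : E →L[ℝ] E) : Prop :=
  ∀ x : ℕ → E, WeaklyNull x → UNConverges (fun n => x n - T (x n)) 0 → UNConverges x 0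

end BanachLattice

/-! In the presence of the positive Schur property, a weakly null un-null sequence is norm null
(`PositiveSchur.tendsto_norm_of_unConverges`): by Kadec–Pełczyński a subsequence is norm close to a
disjoint `y`, then `y` and, by disjointness, `|y|` are weakly null, so `‖y i‖ → 0`. The property
also makes the norm order continuous, so uo-null implies un-null; conversely norm null sequences
have uo-null subsequences. Hence both conditions on `T` say that a weakly null `x` with `x - T x`
norm null is itself norm null. -/

namespace BanachLattice

/-! ### Disjointness and truncation -/

section OrderedGroup

variable {E : Type*} [AddCommGroup E] [Lattice E] [IsOrderedAddMonoid E]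

lemma inf_add_le_inf_add_inf {a b c : E} (ha : 0 ≤ a) (hb : 0 ≤ b) (hc : 0 ≤ c) :
    a ⊓ (b + c) ≤ a ⊓ b + a ⊓ c := by
  rw [add_inf, inf_add, inf_add]
  refine le_inf (le_inf ?_ ?_) (le_inf ?_ ?_)
  · exact inf_le_left.trans (le_add_of_nonneg_right ha)
  · exact inf_le_left.trans (le_add_of_nonneg_left hb)
  · exact inf_le_left.trans (le_add_of_nonneg_right hc)
  · exact inf_le_right

lemma abs_inf_abs_sum_eq_zero {ι : Type*} (a : E) (u : ι → E) (s : Finset ι)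
    (h : ∀ i ∈ s, |a| ⊓ |u i| = 0) : |a| ⊓ |∑ i ∈ s, u i| = 0 := by
  classical
  induction s using Finset.induction_on with
  | empty => simp
  | insert i s hi ih =>
    rw [Finset.sum_insert hi]
    refine le_antisymm ?_ (le_inf (abs_nonneg _) (abs_nonneg _))
    calc |a| ⊓ |u i + ∑ j ∈ s, u j| ≤ |a| ⊓ (|u i| + |∑ j ∈ s, u j|) :=
          inf_le_inf_left _ (abs_add_le _ _)
      _ ≤ |a| ⊓ |u i| + |a| ⊓ |∑ j ∈ s, u j| :=
          inf_add_le_inf_add_inf (abs_nonneg _) (abs_nonneg _) (abs_nonneg _)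
      _ = 0 := by
          rw [h i (Finset.mem_insert_self i s),
            ih fun j hj => h j (Finset.mem_insert_of_mem hj), add_zero]

/-- `|a + b|` dominates `||a| - |b|| = |a| ⊔ |b| - |a| ⊓ |b|`, which disjointness turns into `|a| +
|b|`. -/
lemma abs_add_eq_of_disjoint {a b : E} (h : |a| ⊓ |b| = 0) : |a + b| = |a| + |b| := by
  refine le_antisymm (abs_add_le _ _) ?_
  have h₁ := abs_abs_sub_abs_le a (-b)
  rw [abs_neg, sub_neg_eq_add, abs_sub_comm, ← sup_sub_inf_eq_abs_sub, h, sub_zero] at h₁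
  have h₂ := inf_add_sup |a| |b|
  rw [h, zero_add] at h₂
  rwa [← h₂]

lemma abs_sum_eq_of_pairwise_disjoint {ι : Type*} (u : ι → E)
    (h : Pairwise fun i j => |u i| ⊓ |u j| = 0) (s : Finset ι) :
    |∑ i ∈ s, u i| = ∑ i ∈ s, |u i| := by
  classical
  induction s using Finset.induction_on with
  | empty => simp
  | insert i s hi ih =>
    rw [Finset.sum_insert hi, Finset.sum_insert hi, abs_add_eq_of_disjoint, ih]
    exact abs_inf_abs_sum_eq_zero _ _ _ fun j hj => h fun hij => hi (hij ▸ hj)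

lemma abs_sum_le_sum_abs' {ι : Type*} (u : ι → E) (s : Finset ι) :
    |∑ i ∈ s, u i| ≤ ∑ i ∈ s, |u i| :=
  Finset.le_sum_of_subadditive _ abs_zero.le abs_add_le s u

/-- The part of `x` that exceeds `w` in modulus. -/
def truncate (w x : E) : E := x - ((x ⊓ w) ⊔ -w)

lemma abs_sub_truncate_le {w : E} (hw : 0 ≤ w) (x : E) : |x - truncate w x| ≤ w := by
  rw [truncate, sub_sub_cancel, abs_le']
  exact ⟨sup_le inf_le_right (neg_le_self hw), neg_le.mp le_sup_right⟩

lemma abs_truncate_le (w x : E) : |truncate w x| ≤ 0 ⊔ (|x| - w) := by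
  rw [truncate, abs_le', neg_sub, sub_sup, sub_inf, sup_sub, sub_self]
  refine ⟨inf_le_left.trans (sup_le_sup_left (sub_le_sub_right (le_abs_self x) w) 0),
    sup_le_sup (sub_nonpos.mpr inf_le_left) ?_⟩
  rw [sub_eq_add_neg, add_comm, ← sub_eq_add_neg]
  exact sub_le_sub_right (neg_le_abs x) w

/-- The truncations are dominated by `|x| - m` and `|y| - m` with `m = |x| ⊓ |y|`, and these have
infimum `0`. -/
lemma truncate_disjoint {x y v w : E} (hv : |x| ⊓ |y| ≤ v) (hw : |x| ⊓ |y| ≤ w) :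
    |truncate v x| ⊓ |truncate w y| = 0 := by
  refine le_antisymm ?_ (le_inf (abs_nonneg _) (abs_nonneg _))
  have h₁ : |truncate v x| ≤ |x| - |x| ⊓ |y| := (abs_truncate_le v x).trans
    (sup_le (sub_nonneg.mpr inf_le_left) (sub_le_sub_left hv _))
  have h₂ : |truncate w y| ≤ |y| - |x| ⊓ |y| := (abs_truncate_le w y).trans
    (sup_le (sub_nonneg.mpr inf_le_right) (sub_le_sub_left hw _))
  exact (inf_le_inf h₁ h₂).trans_eq (by rw [← inf_sub, sub_self])

end OrderedGroup

/-! ### Scalars and disjointness -/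

section Module

variable {E : Type*} [AddCommGroup E] [Module ℝ E] [Lattice E] [IsOrderedAddMonoid E]
  [IsOrderedModule ℝ E]

lemma abs_smul_eq (c : ℝ) (a : E) : |c • a| = |c| • |a| := by
  have hpos : ∀ (d : ℝ), 0 < d → |d • a| = d • |a| := fun d hd => by
    have := (OrderIso.smulRight (β := E) hd).map_sup a (-a)
    simp only [OrderIso.smulRight_apply, smul_neg] at this
    exact this.symm
  rcases lt_trichotomy c 0 with hc | rfl | hc
  · rw [abs_of_neg hc, ← hpos _ (neg_pos.mpr hc), neg_smul, abs_neg]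
  · simp
  · rw [abs_of_pos hc, hpos c hc]

lemma smul_disjoint {a b : E} (h : |a| ⊓ |b| = 0) (c d : ℝ) : |c • a| ⊓ |d • b| = 0 := by
  refine le_antisymm ?_ (le_inf (abs_nonneg _) (abs_nonneg _))
  have hm : 0 < max (max |c| |d|) 1 := lt_max_of_lt_right one_pos
  rw [abs_smul_eq, abs_smul_eq]
  refine (inf_le_inf
    (smul_le_smul_of_nonneg_right ((le_max_left |c| |d|).trans (le_max_left _ 1)) (abs_nonneg a))
    (smul_le_smul_of_nonneg_right
      ((le_max_right |c| |d|).trans (le_max_left _ 1)) (abs_nonneg b))).trans_eq ?_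
  have := (OrderIso.smulRight (β := E) hm).map_inf |a| |b|
  simp only [OrderIso.smulRight_apply] at this
  rw [← this, h, smul_zero]

end Module

lemma norm_le_norm_of_abs_le {E : Type*} [NormedAddCommGroup E] [Lattice E] [HasSolidNorm E]
    {a b : E} (h : |a| ≤ b) : ‖a‖ ≤ ‖b‖ :=
  norm_le_norm_of_abs_le_abs (h.trans (le_abs_self b))

lemma UNConverges.comp_tendsto {E : Type*} [NormedAddCommGroup E] [Lattice E] {x : ℕ → E} {a : E}
    (h : UNConverges x a) {φ : ℕ → ℕ}
    (hφ : Tendsto φ atTop atTop) : UNConverges (x ∘ φ) a :=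
  fun y hy => (h y hy).comp hφ

/-- An unbounded norm null sequence has a subsequence with almost disjoint terms. -/
lemma UNConverges.exists_almost_disjoint_subseq {E : Type*} [NormedAddCommGroup E] [Lattice E]
    [IsOrderedAddMonoid E] {x : ℕ → E} (h : UNConverges x 0) :
    ∃ φ : ℕ → ℕ, StrictMono φ ∧
      ∀ i j, i ≠ j → ‖|x (φ i)| ⊓ |x (φ j)|‖ ≤ (1 / 2) ^ i * (1 / 2) ^ j := by
  -- The first coordinate is a strictly increasing counter, hence at least the position in the
  -- sequence; it sets the tolerance.
  obtain ⟨f, -, hf⟩ := exists_seq_of_forall_finset_exists (fun _ : ℕ × ℕ => True)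
    (fun p q => p.1 < q.1 ∧ p.2 < q.2 ∧ ‖|x p.2| ⊓ |x q.2|‖ ≤ (1 / 4) ^ q.1) (fun s _ => by
      have hk : ∀ᶠ k : ℕ in atTop, ∀ p ∈ s, p.1 < k :=
        (eventually_all_finset s).mpr fun p _ => eventually_gt_atTop p.1
      obtain ⟨k, hk⟩ := hk.exists
      have hn : ∀ᶠ n : ℕ in atTop, ∀ p ∈ s, p.2 < n ∧ ‖|x p.2| ⊓ |x n|‖ ≤ (1 / 4) ^ k := by
        refine (eventually_all_finset s).mpr fun p _ => (eventually_gt_atTop p.2).and ?_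
        filter_upwards [(h _ (abs_nonneg (x p.2))).eventually_le_const
          (show (0 : ℝ) < (1 / 4) ^ k by positivity)] with n hn
        rwa [sub_zero, inf_comm] at hn
      obtain ⟨n, hn⟩ := hn.exists
      exact ⟨(k, n), trivial, fun p hp => ⟨hk p hp, hn p hp⟩⟩)
  have hmono : StrictMono fun i => (f i).1 := fun i j hij => (hf i j hij).1
  have key : ∀ i j, i < j → ‖|x (f i).2| ⊓ |x (f j).2|‖ ≤ (1 / 2) ^ i * (1 / 2) ^ j := by
    intro i j hij
    calc ‖|x (f i).2| ⊓ |x (f j).2|‖ ≤ (1 / 4) ^ (f j).1 := (hf i j hij).2.2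
      _ ≤ (1 / 4) ^ j := pow_le_pow_of_le_one (by norm_num) (by norm_num) (hmono.le_apply)
      _ = (1 / 2) ^ j * (1 / 2) ^ j := by rw [← mul_pow]; norm_num
      _ ≤ (1 / 2) ^ i * (1 / 2) ^ j := by
          gcongr ?_ * _
          exact pow_le_pow_of_le_one (by norm_num) (by norm_num) hij.le
  refine ⟨fun i => (f i).2, fun i j hij => (hf i j hij).2.1, fun i j hij => ?_⟩
  rcases hij.lt_or_gt with hij | hij
  · exact key i j hij
  · rw [inf_comm, mul_comm]
    exact key j i hij

/-! ### Disjoint approximation -/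

section NormedLattice

variable {E : Type*} [NormedAddCommGroup E] [Lattice E] [IsOrderedAddMonoid E] [HasSolidNorm E]

lemma norm_le_norm_of_nonneg_of_le {a b : E} (ha : 0 ≤ a) (h : a ≤ b) : ‖a‖ ≤ ‖b‖ :=
  norm_le_norm_of_abs_le ((abs_of_nonneg ha).trans_le h)

lemma UNConverges.of_tendsto_norm {x : ℕ → E} (h : Tendsto (fun n => ‖x n‖) atTop (𝓝 0)) :
    UNConverges x 0 := fun y hy => by
  refine squeeze_zero (fun _ => norm_nonneg _) (fun n => ?_) h
  rw [sub_zero, ← norm_abs_eq_norm (x n)]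
  exact norm_le_norm_of_nonneg_of_le (le_inf (abs_nonneg _) hy) inf_le_left

/-- Kadec–Pełczyński: an unbounded norm null sequence has a subsequence that is norm close to a
disjoint sequence. -/
lemma UNConverges.exists_disjoint_approx [CompleteSpace E] {x : ℕ → E} (h : UNConverges x 0) :
    ∃ (φ : ℕ → ℕ) (y : ℕ → E), StrictMono φ ∧ (Pairwise fun i j => |y i| ⊓ |y j| = 0) ∧
      Tendsto (fun i => x (φ i) - y i) atTop (𝓝 0) := by
  obtain ⟨φ, hφ, hdisj⟩ := h.exists_almost_disjoint_subseq
  -- Zero on the diagonal, so that the row sum `w i` bounds only the overlaps with the other terms.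
  let v : ℕ → ℕ → E := fun i j => if i = j then 0 else |x (φ i)| ⊓ |x (φ j)|
  have hv₀ : ∀ i j, 0 ≤ v i j := fun i j => by
    by_cases hij : i = j
    · simp [v, hij]
    · simp [v, hij]
  have hv : ∀ i j, ‖v i j‖ ≤ (1 / 2) ^ i * (1 / 2) ^ j := fun i j => by
    by_cases hij : i = j
    · simp only [v, hij, if_true, norm_zero]; positivity
    · simpa only [v, hij, if_false] using hdisj i j hij
  have hg : ∀ i : ℕ, HasSum (fun j : ℕ => (1 / 2 : ℝ) ^ i * (1 / 2) ^ j) ((1 / 2) ^ i * 2) :=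
    fun i => hasSum_geometric_two.mul_left _
  have hs : ∀ i, Summable (v i) := fun i => .of_norm_bounded (hg i).summable (hv i)
  let w : ℕ → E := fun i => ∑' j, v i j
  have hw₀ : ∀ i, 0 ≤ w i := fun i => tsum_nonneg (hv₀ i)
  have hw : ∀ i, ‖w i‖ ≤ (1 / 2) ^ i * 2 := fun i => tsum_of_norm_bounded (hg i) (hv i)
  have hle : ∀ i j, i ≠ j → |x (φ i)| ⊓ |x (φ j)| ≤ w i := fun i j hij => by
    have := (hs i).le_tsum j fun k _ => hv₀ i k
    simpa only [v, hij, if_false] using this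
  refine ⟨φ, fun i => truncate (w i) (x (φ i)), hφ, fun i j hij => ?_, ?_⟩
  · exact truncate_disjoint (hle i j hij) (inf_comm |x (φ j)| |x (φ i)| ▸ hle j i hij.symm)
  · refine squeeze_zero_norm (fun i =>
      (norm_le_norm_of_abs_le (abs_sub_truncate_le (hw₀ i) _)).trans (hw i)) ?_
    simpa using (tendsto_pow_atTop_nhds_zero_of_lt_one (r := (1 / 2 : ℝ)) (by norm_num)
      (by norm_num)).mul_const 2

end NormedLattice

/-! ### Weakly null sequences -/

section Weak

variable {E : Type*} [NormedAddCommGroup E] [NormedSpace ℝ E]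

lemma WeaklyNull.comp_tendsto {x : ℕ → E} (h : WeaklyNull x) {φ : ℕ → ℕ}
    (hφ : Tendsto φ atTop atTop) : WeaklyNull (x ∘ φ) :=
  fun f => (h f).comp hφ

lemma WeaklyNull.sub {x y : ℕ → E} (hx : WeaklyNull x) (hy : WeaklyNull y) :
    WeaklyNull fun n => x n - y n := fun f => by
  simpa using (hx f).sub (hy f)

lemma WeaklyNull.map {x : ℕ → E} (hx : WeaklyNull x) (T : E →L[ℝ] E) :
    WeaklyNull fun n => T (x n) := fun f => hx (f.comp T)

lemma WeaklyNull.of_tendsto {x : ℕ → E} (h : Tendsto x atTop (𝓝 0)) : WeaklyNull x := fun f => by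
  simpa [Function.comp_def] using (f.continuous.tendsto 0).comp h

end Weak

/-! ### Disjoint sequences and the Schur property -/

section Disjoint

variable {E : Type*} [NormedAddCommGroup E] [NormedSpace ℝ E] [Lattice E] [IsOrderedAddMonoid E]
  [IsOrderedModule ℝ E] [HasSolidNorm E]

lemma norm_sum_smul_abs_le {y : ℕ → E} (hy : Pairwise fun i j => |y i| ⊓ |y j| = 0)
    (s : Finset ℕ) (c : ℕ → ℝ) : ‖∑ i ∈ s, c i • |y i|‖ ≤ ‖∑ i ∈ s, c i • y i‖ := by
  refine norm_le_norm_of_abs_le_abs ?_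
  rw [abs_sum_eq_of_pairwise_disjoint (fun i => c i • y i)
    fun i j hij => smul_disjoint (hy hij) _ _]
  refine (abs_sum_le_sum_abs' _ _).trans_eq (Finset.sum_congr rfl fun i _ => ?_)
  rw [abs_smul_eq, abs_smul_eq, abs_abs]

/-- For a disjoint sequence `y`, every functional acts on `|y|` as some functional acts on `y`. -/
lemma exists_dual_eq_abs {y : ℕ → E} (hy : Pairwise fun i j => |y i| ⊓ |y j| = 0)
    (f : StrongDual ℝ E) : ∃ g : StrongDual ℝ E, ∀ i, g (y i) = f |y i| := by
  let A : (ℕ →₀ ℝ) →ₗ[ℝ] E := Finsupp.linearCombination ℝ y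
  let B : (ℕ →₀ ℝ) →ₗ[ℝ] ℝ := f.toLinearMap ∘ₗ Finsupp.linearCombination ℝ fun i => |y i|
  have hB : ∃ C : ℝ, ∀ c, ‖B c‖ ≤ C * ‖A c‖ := ⟨‖f‖, fun c =>
    (f.le_opNorm _).trans (mul_le_mul_of_nonneg_left
      (norm_sum_smul_abs_le hy c.support c) (norm_nonneg f))⟩
  -- Hahn–Banach for `∑ c i • y i ↦ f (∑ c i • |y i|)`, well defined and bounded on the span of `y`
  -- by `hB`.
  obtain ⟨g, hg, -⟩ := exists_extension_norm_eq (LinearMap.range A) (B.compLeftInverse A)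
  refine ⟨g, fun i => ?_⟩
  have h₁ : A (Finsupp.single i 1) = y i := by simp [A]
  have h₂ := hg ⟨A (Finsupp.single i 1), LinearMap.mem_range_self A _⟩
  rw [LinearMap.compLeftInverse_apply_of_bdd B A hB (Finsupp.single i 1)] at h₂
  · simpa [h₁, B] using h₂
  · rfl

lemma WeaklyNull.abs_of_disjoint {y : ℕ → E} (h : WeaklyNull y)
    (hy : Pairwise fun i j => |y i| ⊓ |y j| = 0) : WeaklyNull fun i => |y i| := fun f => by
  obtain ⟨g, hg⟩ := exists_dual_eq_abs hy f
  simpa only [hg] using h g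

lemma PositiveSchur.tendsto_norm_of_unConverges [CompleteSpace E] (hE : PositiveSchur E)
    {x : ℕ → E} (hx : WeaklyNull x) (hu : UNConverges x 0) :
    Tendsto (fun n => ‖x n‖) atTop (𝓝 0) := by
  refine tendsto_of_subseq_tendsto fun ns hns => ?_
  obtain ⟨φ, y, hφ, hy, hxy⟩ := (hu.comp_tendsto hns).exists_disjoint_approx
  have hwy : WeaklyNull y := by
    simpa using ((hx.comp_tendsto hns).comp_tendsto hφ.tendsto_atTop).sub (.of_tendsto hxy)
  have hny := hE _ (fun i => abs_nonneg (y i)) (hwy.abs_of_disjoint hy)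
  simp only [norm_abs_eq_norm] at hny
  refine ⟨φ, ?_⟩
  simpa using (hxy.add (tendsto_zero_iff_norm_tendsto_zero.mpr hny)).norm

end Disjoint

/-! ### Order continuity of the norm -/

section OrderContinuity

variable {E : Type*} [NormedAddCommGroup E] [NormedSpace ℝ E] [Lattice E] [IsOrderedAddMonoid E]
  [HasSolidNorm E]

/-- With suitable signs, `∑ |f (w n)| = f (∑ ± w n) ≤ ‖f‖ * ‖z‖`, so `f (w n)` is summable. -/
lemma weaklyNull_of_sum_range_le {w : ℕ → E} {z : E} (hw : ∀ n, 0 ≤ w n)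
    (hz : ∀ N, ∑ n ∈ Finset.range N, w n ≤ z) : WeaklyNull w := fun f => by
  have hs : Summable fun n => |f (w n)| := by
    refine summable_of_sum_range_le (c := ‖f‖ * ‖z‖) (fun _ => abs_nonneg _) fun N => ?_
    let u : ℕ → E := fun n => if 0 ≤ f (w n) then w n else -w n
    have hu : ∀ n, |u n| = w n := fun n => by
      by_cases h : 0 ≤ f (w n) <;> simp [u, h, abs_of_nonneg (hw n)]
    have hfu : ∀ n, |f (w n)| = f (u n) := fun n => by
      by_cases h : 0 ≤ f (w n)
      · simp [u, h, abs_of_nonneg h]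
      · simp [u, h, abs_of_neg (not_le.mp h)]
    calc ∑ n ∈ Finset.range N, |f (w n)| = f (∑ n ∈ Finset.range N, u n) := by
          rw [map_sum]; exact Finset.sum_congr rfl fun n _ => hfu n
      _ ≤ ‖f (∑ n ∈ Finset.range N, u n)‖ := Real.le_norm_self _
      _ ≤ ‖f‖ * ‖∑ n ∈ Finset.range N, u n‖ := f.le_opNorm _
      _ ≤ ‖f‖ * ‖z‖ := by
          gcongr
          refine norm_le_norm_of_abs_le ((abs_sum_le_sum_abs' _ _).trans ?_)
          simpa only [hu] using hz N
  exact (tendsto_zero_iff_abs_tendsto_zero _).mpr hs.tendsto_atTop_zero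

/-- The norm of a Banach lattice with the positive Schur property is order continuous. -/
lemma PositiveSchur.exists_norm_lt_of_antitone [CompleteSpace E] (hE : PositiveSchur E)
    {Γ : Type*} [Preorder Γ] [Nonempty Γ] [IsDirected Γ (· ≤ ·)] {z : Γ → E} (hz : Antitone z)
    (hinf : IsGLB (Set.range z) 0) {ε : ℝ} (hε : 0 < ε) : ∃ γ, ‖z γ‖ < ε := by
  have hz₀ : ∀ γ, 0 ≤ z γ := fun γ => hinf.1 ⟨γ, rfl⟩
  -- Otherwise some chain has positive increments of norm at least `δ` with partial sums below `z (g
  -- 0)`; they are weakly null, against the Schur property.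
  have hC : ∀ δ : ℝ, 0 < δ → ∃ γ, ∀ γ', γ ≤ γ' → ‖z γ - z γ'‖ < δ := by
    by_contra! hcon
    obtain ⟨δ, hδ, hcon⟩ := hcon
    choose s hs hsδ using hcon
    let g : ℕ → Γ := fun n => s^[n] (Classical.arbitrary Γ)
    have hg : ∀ n, g (n + 1) = s (g n) := fun n => Function.iterate_succ_apply' s n _
    let w : ℕ → E := fun n => z (g n) - z (g (n + 1))
    have hw : ∀ n, 0 ≤ w n := fun n => sub_nonneg.mpr (hz (by rw [hg]; exact hs _))
    have hnull := hE w hw (weaklyNull_of_sum_range_le (z := z (g 0)) hw fun N => by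
      rw [Finset.sum_range_sub' (fun n => z (g n))]
      exact sub_le_self _ (hz₀ _))
    obtain ⟨n, hn⟩ := (hnull.eventually_lt_const hδ).exists
    exact absurd hn (not_lt.mpr (by simpa only [w, hg] using hsδ (g n)))
  have hcauchy : CauchySeq z := by
    refine Metric.cauchy_iff.mpr ⟨inferInstance, fun δ hδ => ?_⟩
    obtain ⟨γ, hγ⟩ := hC (δ / 2) (half_pos hδ)
    refine ⟨z '' Set.Ici γ, image_mem_map (Ici_mem_atTop γ), ?_⟩
    rintro _ ⟨a, ha, rfl⟩ _ ⟨b, hb, rfl⟩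
    have := dist_triangle_left (z a) (z b) (z γ)
    rw [dist_eq_norm (z γ), dist_eq_norm (z γ)] at this
    linarith [hγ a ha, hγ b hb]
  obtain ⟨l, hl⟩ := cauchySeq_tendsto_of_complete hcauchy
  have hl₀ : l = 0 := le_antisymm
    (hinf.2 (by
      rintro _ ⟨γ, rfl⟩
      exact le_of_tendsto hl ((eventually_ge_atTop γ).mono fun _ h => hz h)))
    (ge_of_tendsto' hl hz₀)
  rw [hl₀] at hl
  exact ((tendsto_zero_iff_norm_tendsto_zero.mp hl).eventually_lt_const hε).exists

lemma PositiveSchur.tendsto_norm_of_orderConverges [CompleteSpace E] (hE : PositiveSchur E)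
    {x : ℕ → E} (h : OrderConverges x 0) : Tendsto (fun n => ‖x n‖) atTop (𝓝 0) := by
  obtain ⟨Γ, _, _, _, z, hz, hinf, hx⟩ := h
  refine Metric.tendsto_atTop.mpr fun ε hε => ?_
  obtain ⟨γ, hγ⟩ := hE.exists_norm_lt_of_antitone hz hinf hε
  obtain ⟨n₀, hn₀⟩ := hx γ
  refine ⟨n₀, fun n hn => ?_⟩
  rw [dist_zero_right, norm_norm]
  exact (norm_le_norm_of_abs_le (by simpa using hn₀ n hn)).trans_lt hγ

lemma PositiveSchur.unConverges_of_uoConverges [CompleteSpace E] (hE : PositiveSchur E)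
    {x : ℕ → E} (h : UOConverges x 0) : UNConverges x 0 :=
  fun y hy => hE.tendsto_norm_of_orderConverges (h y hy)

end OrderContinuity

/-! ### From norm null to uo-null -/

section NormNull

variable {E : Type*} [NormedAddCommGroup E] [Lattice E] [IsOrderedAddMonoid E] [HasSolidNorm E]

lemma uoConverges_of_summable_norm [CompleteSpace E] {x : ℕ → E}
    (h : Summable fun n => ‖x n‖) : UOConverges x 0 := fun y hy => by
  have hs : Summable fun n => |x n| := .of_norm (by simpa only [norm_abs_eq_norm] using h)
  have hs' : ∀ k, Summable fun n => |x (n + k)| := fun k => (summable_nat_add_iff k).mpr hs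
  -- The tails of `∑ |x n|` decrease to `0` and dominate the sequence.
  let z : ℕ → E := fun k => ∑' n, |x (n + k)|
  have hstep : ∀ k, z k = |x k| + z (k + 1) := fun k => by
    simp only [z]
    rw [(hs' k).tsum_eq_zero_add]
    simp only [zero_add, add_assoc, add_comm 1 k]
  have hz₀ : ∀ k, 0 ≤ z k := fun k => tsum_nonneg fun _ => abs_nonneg _
  have hz : Antitone z := antitone_nat_of_succ_le fun k => by
    rw [hstep k]; exact le_add_of_nonneg_left (abs_nonneg _)
  have hlim : Tendsto z atTop (𝓝 0) := tendsto_sum_nat_add fun n => |x n|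
  refine ⟨ULift ℕ, inferInstance, inferInstance, inferInstance, fun k => z k.down,
    fun _ _ hab => hz hab, ⟨?_, fun b hb => ?_⟩, fun k => ⟨k.down, fun n hn => ?_⟩⟩
  · rintro _ ⟨k, rfl⟩
    exact hz₀ _
  · exact ge_of_tendsto' hlim fun k => hb ⟨⟨k⟩, rfl⟩
  · beta_reduce
    rw [sub_zero, sub_zero, abs_of_nonneg (le_inf (abs_nonneg _) hy)]
    refine inf_le_left.trans (le_trans ?_ (hz hn))
    rw [hstep n]
    exact le_add_of_nonneg_right (hz₀ _)

lemma exists_uoConverges_subseq [CompleteSpace E] {x : ℕ → E}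
    (h : Tendsto (fun n => ‖x n‖) atTop (𝓝 0)) :
    ∃ φ : ℕ → ℕ, StrictMono φ ∧ UOConverges (x ∘ φ) 0 := by
  obtain ⟨φ, hφ, hle⟩ := extraction_forall_of_eventually fun k : ℕ =>
    h.eventually_le_const (show (0 : ℝ) < (1 / 2) ^ k by positivity)
  exact ⟨φ, hφ, uoConverges_of_summable_norm
    (.of_nonneg_of_le (fun _ => norm_nonneg _) hle summable_geometric_two)⟩

end NormNull

end BanachLattice

theorem mainTheorem1 {E : Type*} [NormedAddCommGroup E] [NormedSpace ℝ E] [CompleteSpace E]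
    [Lattice E] [IsOrderedAddMonoid E] [IsOrderedModule ℝ E] [HasSolidNorm E]
    (hE : BanachLattice.PositiveSchur E) (T : E →L[ℝ] E) :
    BanachLattice.UODemiDunfordPettis T ↔ BanachLattice.UNDemiDunfordPettis T := by
  constructor
  · intro hT x hx hu
    have hn := hE.tendsto_norm_of_unConverges (hx.sub (hx.map T)) hu
    -- `hT` needs a uo-null difference, available only along subsequences, so a further subsequence
    -- is extracted from each one.
    refine .of_tendsto_norm (tendsto_of_subseq_tendsto fun ns hns => ?_)
    obtain ⟨φ, hφ, huo⟩ := BanachLattice.exists_uoConverges_subseq (hn.comp hns)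
    exact ⟨φ, hT _ ((hx.comp_tendsto hns).comp_tendsto hφ.tendsto_atTop) huo⟩
  · intro hT x hx hu
    exact hE.tendsto_norm_of_unConverges hx (hT x hx (hE.unConverges_of_uoConverges hu))
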